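/- Let $k$ be an algebraically closed field of characteristic zero and let $R=k[s,t,u,v]$ be the total coordinate ring of $\mathbb{P}^1\times\mathbb{P}^1$, bigraded by $\deg s=\deg t=(1,0)$ and $\deg u=\deg v=(0,1)$. For a finite set $X\subset\mathbb{P}^1\times\mathbb{P}^1$ of $r$ points, let $I_X\subset R$ be its ideal, i.e. $I_X=\bigcap_{P\in X}I_P$, where $I_{A\times B}=\langle h,l\rangle$ with $h$ a nonzero linear form in $s,t$ vanishing at $A$ and $l$ a nonzero linear form in $u,v$ vanishing at $B$. Call $X$ generic if $\dim_k R_{(i,j)}-\dim_k (I_X)_{(i,j)}=\min\{(i+1)(j+1),r\}$ for all $i,j\ge 0$. Let $X$ be a generic set of $r$ points, let $\kappa=\lfloor r/2\rfloor$, let $a\ge \kappa$ be an integer, and let $U$ be a generic $4$-dimensional subspace of $(I_X)_{(a,1)}$ with basis $f_0,\dots,f_3$. Here "generic" means: for every basis $\mathbf b=(b_1,\dots,b_q)$ of $(I_X)_{(a,1)}$ there is a nonempty Zariski open set of $4\times q$ matrices $C$ over $k$, all of whose maximal minors are nonzero, such that the assertions below hold for every $4$-dimensional $U$ spanned by the entries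 of $C\mathbf b$ with $C$ in this set, and every basis of $U$. (If $q<4$ there is no such $U$ and nothing is asserted.) Let $\mathrm{Syz}(I_U)_{(-,0)}$ be the $k[s,t]$-module of all $(L_0,\dots,L_3)\in k[s,t]^4$ with $L_0f_0+L_1f_1+L_2f_2+L_3f_3=0$; such a syzygy has bidegree $(d,0)$ if all $L_i$ are forms of degree $d$ in $s,t$. Then $\mathrm{Syz}(I_U)_{(-,0)}$ has rank two. Moreover, it is minimally generated by two syzygies, both of bidegree $(a-\kappa,0)$ if $r=2\kappa$, and of bidegrees $(a-\kappa,0)$ and $(a-\kappa-1,0)$ if $r=2\kappa+1$. -/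

import Mathlib

open scoped LinearAlgebra.Projectivization

namespace TensorSurface

/-- The projective line over `K`. -/
abbrev P1 (K : Type*) [Field K] := ℙ K (Fin 2 → K)

/-- The total coordinate ring `R = K[s,t] ⊗ K[u,v] = K[s,t,u,v]` of `ℙ¹ × ℙ¹`:
`s, t` are the variables `inl 0, inl 1` and `u, v` are the variables `inr 0, inr 1`. -/
abbrev CoxRing (K : Type*) [Field K] := MvPolynomial (Fin 2 ⊕ Fin 2) K

/-- The polynomial ring `K[s,t]`. -/
abbrev STRing (K : Type*) [Field K] := MvPolynomial (Fin 2) K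

/-- The bigrading: `deg s = deg t = (1,0)` and `deg u = deg v = (0,1)`. -/
def biweight : Fin 2 ⊕ Fin 2 → ℕ × ℕ := Sum.elim (fun _ => (1, 0)) (fun _ => (0, 1))

variable {K : Type*} [Field K]

variable (K) in
/-- The bigraded piece `R_(i,j) = H⁰(ℙ¹ × ℙ¹, 𝒪(i,j))`. -/
noncomputable def bidegPiece (i j : ℕ) : Submodule K (CoxRing K) :=
  MvPolynomial.weightedHomogeneousSubmodule K biweight (i, j)

/-- The ideal `I_P = ⟨h, l⟩` of a point `P = A × B` of `ℙ¹ × ℙ¹`, where `h = A₁ s - A₀ t` is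
the linear form in `s, t` vanishing at `A` and `l = B₁ u - B₀ v` the linear form in `u, v`
vanishing at `B` (rescaling homogeneous coordinates does not change the ideal). -/
noncomputable def pointIdeal (P : P1 K × P1 K) : Ideal (CoxRing K) :=
  Ideal.span
    {MvPolynomial.C (P.1.rep 1) * MvPolynomial.X (Sum.inl 0)
        - MvPolynomial.C (P.1.rep 0) * MvPolynomial.X (Sum.inl 1),
      MvPolynomial.C (P.2.rep 1) * MvPolynomial.X (Sum.inr 0)
        - MvPolynomial.C (P.2.rep 0) * MvPolynomial.X (Sum.inr 1)}

/-- The ideal `I_X = ⋂_{P ∈ X} I_P` of a finite set of points. -/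
noncomputable def pointsIdeal (X : Finset (P1 K × P1 K)) : Ideal (CoxRing K) :=
  ⨅ P ∈ X, pointIdeal P

/-- The bigraded piece `(I_X)_(i,j)`, as a `K`-vector space. -/
noncomputable def pointsIdealPiece (X : Finset (P1 K × P1 K)) (i j : ℕ) :
    Submodule K (CoxRing K) :=
  (pointsIdeal X).restrictScalars K ⊓ bidegPiece K i j

/-- The bigraded Hilbert function `H_X(i,j) = dim R_(i,j) - dim (I_X)_(i,j)`
(both spaces are finite-dimensional and the second is contained in the first). -/
noncomputable def hilbertFunction (X : Finset (P1 K × P1 K)) (i j : ℕ) : ℕ :=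
  Module.finrank K (bidegPiece K i j) - Module.finrank K (pointsIdealPiece X i j)

/-- A finite set `X` of `r` points is generic if `H_X(i,j) = min {(i+1)(j+1), r}`. -/
def IsGenericPoints (X : Finset (P1 K × P1 K)) : Prop :=
  ∀ i j : ℕ, hilbertFunction X i j = min ((i + 1) * (j + 1)) X.card

/-- The `K[s,t]`-module `Syz(f₀,…,f₃)_(-,0)` of syzygies of degree zero in `u, v`: the tuples
`L` of elements of `K[s,t] ⊆ R` with `L₀ f₀ + L₁ f₁ + L₂ f₂ + L₃ f₃ = 0`. -/
noncomputable def syzDegZero (f : Fin 4 → CoxRing K) :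
    Submodule (STRing K) (Fin 4 → STRing K) where
  carrier := {L | ∑ m, MvPolynomial.rename Sum.inl (L m) * f m = 0}
  zero_mem' := by simp
  add_mem' := by
    intro L M hL hM
    simp only [Set.mem_ofPred_eq] at hL hM ⊢
    simp only [Pi.add_apply, map_add, add_mul, Finset.sum_add_distrib, hL, hM, add_zero]
  smul_mem' := by
    intro c L hL
    simp only [Set.mem_ofPred_eq] at hL ⊢
    simp only [Pi.smul_apply, smul_eq_mul, map_mul, mul_assoc, ← Finset.mul_sum, hL, mul_zero]

/-- The submodule `N` of `K[s,t]⁴` has a minimal system of homogeneous generators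
`g₀, …, g_{n-1}` of degrees `d₀, …, d_{n-1}`. An element of `K[s,t]⁴` is homogeneous of degree
`e` if its entries are forms of degree `e` in `s, t`; as a syzygy it then has
bidegree `(e,0)`. -/
def HasMinimalGenerators (N : Submodule (STRing K) (Fin 4 → STRing K)) {n : ℕ}
    (d : Fin n → ℕ) : Prop :=
  ∃ g : Fin n → Fin 4 → STRing K,
    (∀ i m, (g i m).IsHomogeneous (d i)) ∧
    Submodule.span (STRing K) (Set.range g) = N ∧
    ∀ i, g i ∉ Submodule.span (STRing K) (g '' {i}ᶜ)

/-- `p` holds for a generic subspace `U` of dimension `n` of the (finite-dimensional) space `V`: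
in terms of any basis `b` of `V`, it holds for the span `U` of `C b`, for all `n × q`
coefficient matrices `C` in some nonempty Zariski open set `{C | F(C) ≠ 0}` of matrices all of
whose maximal minors are nonzero. (If `n ≤ q = dim V`, such `U` have dimension `n`.) -/
def HoldsForGenericSubspace {M : Type*} [AddCommGroup M] [Module K M] (n : ℕ)
    (V : Submodule K M) (p : Submodule K M → Prop) : Prop :=
  ∀ (q : ℕ) (b : Module.Basis (Fin q) K V),
    ∃ F : MvPolynomial (Fin n × Fin q) K, F ≠ 0 ∧
      ∀ C : Matrix (Fin n) (Fin q) K, MvPolynomial.eval (fun x => C x.1 x.2) F ≠ 0 →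
        (∀ e : Fin n ↪o Fin q, (C.submatrix id e).det ≠ 0) ∧
        p (Submodule.span K (Set.range fun i => ∑ m, C i m • (b m : M)))

end TensorSurface

namespace TensorSurface

open MvPolynomial
open Finset.HasAntidiagonal (antidiagonal mem_antidiagonal)

variable {K : Type*} [Field K]

/-! Put M_n = (I_X)_(n,1), δ = r - 2κ and c = a - κ. The same principle is applied twice, to M and
to the syzygy module.

Call a graded family N of spaces saturated if every relation s x = t y in N_n has the form x = t z,
y = s z with z in N_(n-1). Then dim (s N_n + t N_n) = 2 dim N_n - dim N_(n-1). If dim N_n = 2(n+1) -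
ρ wherever this is nonnegative, the second difference vanishes, so s N_n + t N_n fills N_(n+1). Two
elements of degrees ⌊ρ/2⌋ and ⌈ρ/2⌉ therefore generate N from degree ⌈ρ/2⌉ on
(`IsSaturatedFamily.exists_generators`), and comparing dimensions shows that they are independent
(`eq_zero_of_generators`).

Genericity of X gives M this Hilbert function with ρ = r, hence generators m₁, m₂. If the forms of
degree c - 1 times f₀, …, f₃ cover M_(a+c-1), then the forms of degree n cover M_(a+n) for all n ≥ c
- 1, and the syzygies of degree n have dimension 4(n+1) - dim M_(a+n) = 2(n+1) - (2c - δ). The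
principle with ρ = 2c - δ now yields syzygies of degrees c - δ and c (`exists_syzygy_basis`).

Covering is a Zariski open condition on the coefficients of the f's (`exists_polynomial_le_range`),
so a single example suffices: s^c m₁, t^c m₁, s^(c-δ) m₂, t^(c-δ) m₂ (`exists_covering_tuple`). In
the code e = c - 1. -/

/-! ### Dimensions of the graded pieces -/

/-- Exponents of `K[s,t]` of degree `n` are the pairs of natural numbers with sum `n`. -/
noncomputable def degreeEquivAntidiagonal (n : ℕ) :
    {d : Fin 2 →₀ ℕ | d.degree = n} ≃ antidiagonal n where
  toFun d := ⟨(d.1 0, d.1 1), by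
    have := d.2
    simpa [Finsupp.degree_eq_sum] using this⟩
  invFun x := ⟨Finsupp.equivFunOnFinite.symm ![x.1.1, x.1.2], by
    simpa [Finsupp.degree_eq_sum] using mem_antidiagonal.1 x.2⟩
  left_inv d := by
    ext i
    fin_cases i <;> simp
  right_inv x := by simp

lemma weight_biweight (d : Fin 2 ⊕ Fin 2 →₀ ℕ) : Finsupp.weight biweight d =
    (d (.inl 0) + d (.inl 1), d (.inr 0) + d (.inr 1)) := by
  rw [Finsupp.weight_apply, Finsupp.sum_fintype _ _ (by simp)]
  ext <;> simp [biweight]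

/-- Exponents of `K[s,t,u,v]` of bidegree `(i,j)`. -/
noncomputable def biweightEquivAntidiagonal (i j : ℕ) :
    {d : Fin 2 ⊕ Fin 2 →₀ ℕ | Finsupp.weight biweight d = (i, j)} ≃
      antidiagonal i × antidiagonal j where
  toFun d := (⟨(d.1 (.inl 0), d.1 (.inl 1)), mem_antidiagonal.2 (by
      simpa using congrArg Prod.fst ((weight_biweight d.1).symm.trans d.2))⟩,
    ⟨(d.1 (.inr 0), d.1 (.inr 1)), mem_antidiagonal.2 (by
      simpa using congrArg Prod.snd ((weight_biweight d.1).symm.trans d.2))⟩)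
  invFun x := ⟨Finsupp.equivFunOnFinite.symm
      (Sum.elim ![x.1.1.1, x.1.1.2] ![x.2.1.1, x.2.1.2]), by
    have h1 := mem_antidiagonal.1 x.1.2
    have h2 := mem_antidiagonal.1 x.2.2
    simp [weight_biweight, h1, h2]⟩
  left_inv d := by
    ext i
    rcases i with i | i <;> fin_cases i <;> simp
  right_inv x := by simp

lemma homogeneousSubmodule_eq_restrictSupport (n : ℕ) :
    homogeneousSubmodule (Fin 2) K n = restrictSupport K {d | d.degree = n} :=
  homogeneousSubmodule_eq_finsupp_supported ..

lemma bidegPiece_eq_restrictSupport (i j : ℕ) :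
    bidegPiece K i j = restrictSupport K {d | Finsupp.weight biweight d = (i, j)} :=
  weightedHomogeneousSubmodule_eq_finsupp_supported ..

instance (n : ℕ) : Module.Finite K (homogeneousSubmodule (Fin 2) K n) := by
  have : Finite {d : Fin 2 →₀ ℕ | d.degree = n} := .of_equiv _ (degreeEquivAntidiagonal n).symm
  rw [homogeneousSubmodule_eq_restrictSupport]
  exact Module.Finite.of_basis (basisRestrictSupport K _)

instance (i j : ℕ) : Module.Finite K (bidegPiece K i j) := by
  have : Finite {d : Fin 2 ⊕ Fin 2 →₀ ℕ | Finsupp.weight biweight d = (i, j)} :=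
    .of_equiv _ (biweightEquivAntidiagonal i j).symm
  rw [bidegPiece_eq_restrictSupport]
  exact Module.Finite.of_basis (basisRestrictSupport K _)

variable (K) in
lemma finrank_homogeneousSubmodule (n : ℕ) :
    Module.finrank K (homogeneousSubmodule (Fin 2) K n) = n + 1 := by
  rw [homogeneousSubmodule_eq_restrictSupport,
    Module.finrank_eq_nat_card_basis (basisRestrictSupport K _),
    Nat.card_congr (degreeEquivAntidiagonal n), Nat.card_eq_fintype_card, Fintype.card_coe,
    Finset.Nat.card_antidiagonal]

variable (K) in
lemma finrank_bidegPiece (i j : ℕ) :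
    Module.finrank K (bidegPiece K i j) = (i + 1) * (j + 1) := by
  rw [bidegPiece_eq_restrictSupport,
    Module.finrank_eq_nat_card_basis (basisRestrictSupport K _),
    Nat.card_congr (biweightEquivAntidiagonal i j), Nat.card_prod,
    Nat.card_eq_fintype_card, Nat.card_eq_fintype_card, Fintype.card_coe, Fintype.card_coe,
    Finset.Nat.card_antidiagonal, Finset.Nat.card_antidiagonal]

/-! ### Division by powers of the variables -/

/-- The only relations between two powers of distinct variables are the Koszul ones. -/
lemma exists_eq_X_pow_mul {σ : Type*} {i j : σ} (hij : i ≠ j) {n : ℕ} {x y : MvPolynomial σ K}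
    (h : X i ^ n * x = X j ^ n * y) : ∃ z, x = X j ^ n * z ∧ y = X i ^ n * z := by
  obtain ⟨z, rfl⟩ : (X j : MvPolynomial σ K) ^ n ∣ x := by
    refine (X_prime (R := K) (i := j)).pow_dvd_of_dvd_mul_left n (a := X i ^ n) ?_ ⟨y, h⟩
    intro hd
    exact hij ((X_dvd_X (R := K)).1 ((X_prime (R := K)).dvd_of_dvd_pow hd)).symm
  refine ⟨z, rfl, ?_⟩
  have hj : (X j : MvPolynomial σ K) ^ n ≠ 0 := pow_ne_zero _ (X_ne_zero j)
  apply mul_left_cancel₀ hj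
  rw [← h]; ring

lemma isHomogeneous_of_X_mul {i : Fin 2} {n : ℕ} {z : STRing K}
    (h : (X i * z).IsHomogeneous (n + 1)) : z.IsHomogeneous n := by
  intro d hd
  have := @h (Finsupp.single i 1 + d) (by rwa [coeff_X_mul])
  simp only [map_add, Finsupp.weight_single, Pi.one_apply, smul_eq_mul, mul_one] at this
  omega

lemma eq_zero_of_X_mul_isHomogeneous_zero {i : Fin 2} {z : STRing K}
    (h : (X i * z).IsHomogeneous 0) : z = 0 := by
  ext d
  by_contra hd
  have := @h (Finsupp.single i 1 + d) (by rwa [coeff_X_mul])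
  simp [map_add, Finsupp.weight_single] at this

lemma mem_bidegPiece_of_X_mul {i : Fin 2} {n j : ℕ} {z : CoxRing K}
    (h : X (.inl i) * z ∈ bidegPiece K (n + 1) j) : z ∈ bidegPiece K n j := by
  intro d hd
  have := @h (Finsupp.single (.inl i) 1 + d) (by rwa [coeff_X_mul])
  simp only [weight_biweight, Prod.ext_iff] at this ⊢
  fin_cases i <;> simp at this <;> omega

lemma eq_zero_of_X_mul_mem_bidegPiece_zero {i : Fin 2} {j : ℕ} {z : CoxRing K}
    (h : X (.inl i) * z ∈ bidegPiece K 0 j) : z = 0 := by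
  ext d
  by_contra hd
  have := @h (Finsupp.single (.inl i) 1 + d) (by rwa [coeff_X_mul])
  simp [map_add, Finsupp.weight_single, biweight, Prod.ext_iff] at this

/-- Monomials of degree `n ≥ 2c - 1` in `s, t` are divisible by `s^c` or `t^c`. -/
lemma exists_eq_mul_X_pow_add {n c e : ℕ} (hn : n = e + c) (hc : 2 * c ≤ n + 1) {p : STRing K}
    (hp : p.IsHomogeneous n) :
    ∃ p₀ p₁ : STRing K, p₀.IsHomogeneous e ∧ p₁.IsHomogeneous e ∧
      p = p₀ * X 0 ^ c + p₁ * X 1 ^ c := by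
  induction hp using IsWeightedHomogeneous.induction_on with
  | zero => exact ⟨0, 0, isHomogeneous_zero .., isHomogeneous_zero .., by simp⟩
  | add p q hp hq ihp ihq =>
    obtain ⟨p₀, p₁, hp₀, hp₁, rfl⟩ := ihp
    obtain ⟨q₀, q₁, hq₀, hq₁, rfl⟩ := ihq
    exact ⟨p₀ + q₀, p₁ + q₁, hp₀.add hq₀, hp₁.add hq₁, by ring⟩
  | monomial d r hd =>
    have hd' : d 0 + d 1 = n := by
      simpa [Finsupp.weight_apply, Finsupp.sum_fintype] using hd
    have key (i : Fin 2) (hi : c ≤ d i) : ∃ q : STRing K, q.IsHomogeneous e ∧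
        monomial d r = q * X i ^ c := by
      have hle : Finsupp.single i c ≤ d := by simpa using hi
      refine ⟨monomial (d - Finsupp.single i c) r, isHomogeneous_monomial r ?_, ?_⟩
      · have h1 : (d - Finsupp.single i c + Finsupp.single i c).degree = e + c := by
          rw [tsub_add_cancel_of_le hle, Finsupp.degree_eq_sum]
          simp; omega
        simpa using h1
      · rw [X_pow_eq_monomial, monomial_mul, mul_one, tsub_add_cancel_of_le hle]
    by_cases h : c ≤ d 0
    · obtain ⟨q, hq, h⟩ := key 0 h
      exact ⟨q, 0, hq, isHomogeneous_zero .., by simp [h]⟩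
    · obtain ⟨q, hq, h⟩ := key 1 (by omega)
      exact ⟨0, q, isHomogeneous_zero .., hq, by simp [h]⟩

/-! ### Saturated families and their two generators -/

section

variable {V W : Type*} [AddCommGroup V] [Module K V] [AddCommGroup W] [Module K W]

lemma finrank_map_add_finrank_inf_ker (P : Submodule K V) [FiniteDimensional K P]
    (T : V →ₗ[K] W) :
    Module.finrank K (P.map T) + Module.finrank K (P ⊓ LinearMap.ker T : Submodule K V) =
      Module.finrank K P := by
  rw [← LinearMap.finrank_range_add_finrank_ker (T.domRestrict P), LinearMap.range_domRestrict,
    LinearMap.ker_domRestrict, ← Submodule.finrank_map_subtype_eq P, Submodule.map_comap_subtype]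

/-- A product of submodules is the product of the modules. -/
def submoduleProdEquiv (P : Submodule K V) (Q : Submodule K W) : P.prod Q ≃ₗ[K] P × Q where
  toFun x := (⟨x.1.1, x.2.1⟩, ⟨x.1.2, x.2.2⟩)
  invFun x := ⟨(x.1, x.2), x.1.2, x.2.2⟩
  map_add' _ _ := rfl
  map_smul' _ _ := rfl

lemma finrank_submodule_prod (P : Submodule K V) (Q : Submodule K W) [FiniteDimensional K P]
    [FiniteDimensional K Q] :
    Module.finrank K (P.prod Q) = Module.finrank K P + Module.finrank K Q := by
  rw [LinearEquiv.finrank_eq (submoduleProdEquiv P Q), Module.finrank_prod]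

instance (P : Submodule K V) (Q : Submodule K W) [FiniteDimensional K P]
    [FiniteDimensional K Q] : FiniteDimensional K (P.prod Q) :=
  Module.Finite.equiv (submoduleProdEquiv P Q).symm

/-- If the relations between `σ` and `τ` on `N` come from `Z` by the Koszul complex and the
dimensions permit it, then `N'` is the sum of the images of `N` under `σ` and `τ`. -/
lemma exists_eq_add_of_koszul (σ τ : W →ₗ[K] W) (N N' Z : Submodule K W)
    [FiniteDimensional K N] [FiniteDimensional K N'] [FiniteDimensional K Z]
    (hσ : ∀ x ∈ N, σ x ∈ N') (hτ : ∀ x ∈ N, τ x ∈ N')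
    (hZ : ∀ x ∈ N, ∀ y ∈ N, σ x = τ y → ∃ z ∈ Z, x = τ z ∧ y = σ z)
    (hdim : Module.finrank K N' + Module.finrank K Z ≤ 2 * Module.finrank K N)
    {w : W} (hw : w ∈ N') : ∃ x ∈ N, ∃ y ∈ N, w = σ x + τ y := by
  set T : W × W →ₗ[K] W := σ.coprod τ
  have h := finrank_map_add_finrank_inf_ker (N.prod N) T
  rw [finrank_submodule_prod] at h
  -- The kernel of (x, y) ↦ σ x + τ y consists of Koszul pairs (τ z, -σ z), so its dimension is at
  -- most that of Z.
  have hker : N.prod N ⊓ LinearMap.ker T ≤ Z.map (τ.prod (-σ)) := by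
    rintro ⟨x, y⟩ ⟨⟨hx, hy⟩, hxy⟩
    obtain ⟨z, hz, h1, h2⟩ := hZ x hx (-y) (N.neg_mem hy)
      (by rw [map_neg]; exact eq_neg_of_add_eq_zero_left (by simpa [T] using hxy))
    exact ⟨z, hz, by simp [h1, ← h2]⟩
  have h1 := (Submodule.finrank_mono hker).trans (Submodule.finrank_map_le _ Z)
  have hle : (N.prod N).map T ≤ N' := by
    rintro _ ⟨⟨x, y⟩, ⟨hx, hy⟩, rfl⟩
    exact N'.add_mem (hσ x hx) (hτ y hy)
  have heq := Submodule.eq_of_le_of_finrank_le hle (by omega)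
  rw [← heq] at hw
  obtain ⟨⟨x, y⟩, ⟨hx, hy⟩, rfl⟩ := hw
  exact ⟨x, hx, y, hy, rfl⟩

/-- A graded family of subspaces, stable under a torsion-free action of `K[s,t]`, on which
all relations between multiplication by `s` and by `t` are of Koszul type. -/
structure IsSaturatedFamily (ρ : STRing K →ₐ[K] Module.End K W) (N : ℕ → Submodule K W) :
    Prop where
  X_mem : ∀ i n x, x ∈ N n → ρ (X i) x ∈ N (n + 1)
  koszul : ∀ n, ∀ x ∈ N n, ∀ y ∈ N n, ρ (X 0) x = ρ (X 1) y →
    ∃ z, x = ρ (X 1) z ∧ y = ρ (X 0) z ∧ (n = 0 → z = 0) ∧ ∀ m, n = m + 1 → z ∈ N m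
  torsionFree : ∀ p x, ρ p x = 0 → p = 0 ∨ x = 0

namespace IsSaturatedFamily

variable {ρ : STRing K →ₐ[K] Module.End K W} {N : ℕ → Submodule K W}
  [∀ n, FiniteDimensional K (N n)] {r : ℕ}

/-- The dimension formula is affine in n, so dim N_(n+1) + dim N_(n-1) = 2 dim N_n, which is what
the Koszul count needs. The bound r ≤ 2n makes the formula available already in degree n - 1. -/
lemma exists_eq_X_add_X (h : IsSaturatedFamily ρ N)
    (hdim : ∀ n, r ≤ 2 * (n + 1) → Module.finrank K (N n) + r = 2 * (n + 1))
    {n : ℕ} (hn : r ≤ 2 * n) {w : W} (hw : w ∈ N (n + 1)) :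
    ∃ x ∈ N n, ∃ y ∈ N n, w = ρ (X 0) x + ρ (X 1) y := by
  have h0 := hdim n (by omega)
  have h1 := hdim (n + 1) (by omega)
  cases n with
  | zero =>
    -- Here N_(-1) is zero, and r = 0 is forced.
    refine exists_eq_add_of_koszul _ _ _ _ ⊥ (h.X_mem 0 _) (h.X_mem 1 _) ?_ ?_ hw
    · intro x hx y hy hxy
      obtain ⟨z, hz, hz', hz0, -⟩ := h.koszul _ x hx y hy hxy
      exact ⟨z, by simp [hz0], hz, hz'⟩
    · rw [finrank_bot]; omega
  | succ m =>
    have h2 := hdim m (by omega)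
    refine exists_eq_add_of_koszul _ _ _ _ (N m) (h.X_mem 0 _) (h.X_mem 1 _) ?_ ?_ hw
    · intro x hx y hy hxy
      obtain ⟨z, hz, hz', -, hz0⟩ := h.koszul _ x hx y hy hxy
      exact ⟨z, hz0 m rfl, hz, hz'⟩
    · omega

/-- For δ = 0 a basis of the plane N_κ works. For δ = 1 the space N_κ is a line spanned by m₁, the
elements s m₁ and t m₁ are independent by torsion-freeness, and m₂ completes them to a basis of the
three-dimensional N_(κ+1). -/
lemma exists_generators_base (h : IsSaturatedFamily ρ N) {κ δ : ℕ} (hδ : δ ≤ 1)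
    (hκ : Module.finrank K (N κ) + δ = 2) (hκ' : Module.finrank K (N (κ + δ)) = 2 + δ) :
    ∃ m₁ ∈ N κ, ∃ m₂ ∈ N (κ + δ), ∀ x ∈ N (κ + δ), ∃ p q : STRing K,
      p.IsHomogeneous δ ∧ q.IsHomogeneous 0 ∧ x = ρ p m₁ + ρ q m₂ := by
  have hC (c : K) (x : W) : ρ (C c) x = c • x := by
    rw [← algebraMap_eq, AlgHom.commutes, Module.algebraMap_end_apply]
  obtain rfl | rfl : δ = 0 ∨ δ = 1 := by omega
  · let b := Module.finBasisOfFinrankEq K (N κ) hκ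
    refine ⟨b 0, (b 0).2, b 1, (b 1).2, fun x hx ↦ ?_⟩
    refine ⟨C (b.repr ⟨x, hx⟩ 0), C (b.repr ⟨x, hx⟩ 1), isHomogeneous_C .., isHomogeneous_C ..,
      ?_⟩
    have := congrArg Subtype.val (b.sum_repr ⟨x, hx⟩)
    simp only [Fin.sum_univ_two, Submodule.coe_add, Submodule.coe_smul] at this
    rw [hC, hC, this]
  · obtain ⟨⟨m₁, hm₁⟩, hm₁0, -⟩ := finrank_eq_one_iff'.1 (show Module.finrank K (N κ) = 1 by omega)
    have hm₁0 : m₁ ≠ 0 := fun h0 ↦ hm₁0 (by simpa using h0)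
    set A : Submodule K W := Submodule.span K {ρ (X 0) m₁, ρ (X 1) m₁} with hA
    have hAN : A ≤ N (κ + 1) := by
      rw [hA, Submodule.span_le]
      rintro _ (rfl | rfl)
      exacts [h.X_mem _ _ _ hm₁, h.X_mem _ _ _ hm₁]
    have := Submodule.finiteDimensional_of_le hAN
    have hli : LinearIndependent K ![ρ (X 0) m₁, ρ (X 1) m₁] := by
      rw [LinearIndependent.pair_iff]
      intro α β hαβ
      have h0 : ρ (C α * X 0 + C β * X 1) m₁ = 0 := by
        rw [map_add, map_mul, map_mul, LinearMap.add_apply, Module.End.mul_apply,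
          Module.End.mul_apply, hC, hC, hαβ]
      have h1 := (h.torsionFree _ _ h0).resolve_right hm₁0
      constructor
      · simpa using congrArg (MvPolynomial.eval ![1, 0]) h1
      · simpa using congrArg (MvPolynomial.eval ![0, 1]) h1
    have hA2 : Module.finrank K A = 2 := by
      have := finrank_span_eq_card hli
      rwa [Matrix.range_cons, Matrix.range_cons, Matrix.range_empty, Set.union_empty,
        Set.singleton_union, Fintype.card_fin] at this
    obtain ⟨m₂, hm₂, hm₂A⟩ : ∃ m₂ ∈ N (κ + 1), m₂ ∉ A := by
      by_contra! hc
      have := Submodule.finrank_mono (R := K) (show N (κ + 1) ≤ A from hc)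
      omega
    refine ⟨m₁, hm₁, m₂, hm₂, fun x hx ↦ ?_⟩
    have hlt : A < A ⊔ Submodule.span K {m₂} :=
      lt_of_le_of_ne le_sup_left fun he ↦
        hm₂A (he ▸ Submodule.mem_sup_right (Submodule.mem_span_singleton_self m₂))
    have hle : A ⊔ Submodule.span K {m₂} ≤ N (κ + 1) :=
      sup_le hAN (by simpa using hm₂)
    have := Submodule.finiteDimensional_of_le hle
    have := Submodule.finrank_lt_finrank_of_lt hlt
    rw [← Submodule.eq_of_le_of_finrank_le hle (by omega)] at hx
    obtain ⟨y, hy, z, hz, rfl⟩ := Submodule.mem_sup.1 hx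
    obtain ⟨α, β, rfl⟩ := Submodule.mem_span_pair.1 hy
    obtain ⟨γ, rfl⟩ := Submodule.mem_span_singleton.1 hz
    refine ⟨C α * X 0 + C β * X 1, C γ, (isHomogeneous_C_mul_X ..).add (isHomogeneous_C_mul_X ..),
      isHomogeneous_C .., ?_⟩
    rw [map_add, map_mul, map_mul, LinearMap.add_apply, Module.End.mul_apply,
          Module.End.mul_apply, hC, hC, hC]

/-- A saturated family with Hilbert function `2(n+1) - r` is generated by two elements, of degrees
`⌊r/2⌋` and `⌈r/2⌉`. -/
theorem exists_generators (h : IsSaturatedFamily ρ N) {κ δ : ℕ} (hδ : δ ≤ 1)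
    (hr : r = 2 * κ + δ)
    (hdim : ∀ n, r ≤ 2 * (n + 1) → Module.finrank K (N n) + r = 2 * (n + 1)) :
    ∃ m₁ ∈ N κ, ∃ m₂ ∈ N (κ + δ), ∀ j, ∀ x ∈ N (κ + δ + j), ∃ p q : STRing K,
      p.IsHomogeneous (δ + j) ∧ q.IsHomogeneous j ∧ x = ρ p m₁ + ρ q m₂ := by
  have h1 := hdim κ (by omega)
  have h2 := hdim (κ + δ) (by omega)
  obtain ⟨m₁, hm₁, m₂, hm₂, hgen⟩ := h.exists_generators_base (κ := κ) hδ (by omega) (by omega)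
  refine ⟨m₁, hm₁, m₂, hm₂, fun j ↦ ?_⟩
  induction j with
  | zero => exact hgen
  | succ j ih =>
    intro w hw
    obtain ⟨x, hx, y, hy, rfl⟩ :=
      h.exists_eq_X_add_X hdim (n := κ + δ + j) (by omega) hw
    obtain ⟨p, q, hp, hq, rfl⟩ := ih x hx
    obtain ⟨p', q', hp', hq', rfl⟩ := ih y hy
    refine ⟨p * X 0 + p' * X 1, q * X 0 + q' * X 1, (hp.mul (isHomogeneous_X ..)).add
      (hp'.mul (isHomogeneous_X ..)), (hq.mul (isHomogeneous_X ..)).add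
      (hq'.mul (isHomogeneous_X ..)), ?_⟩
    simp only [mul_comm _ (X _), map_add, map_mul, LinearMap.add_apply, Module.End.mul_apply]
    abel

end IsSaturatedFamily

/-- The two generators of a family with Hilbert function `2(n+1) - r` are independent. -/
theorem eq_zero_of_generators {ρ : STRing K →ₐ[K] Module.End K W} {N : ℕ → Submodule K W}
    {κ δ : ℕ} {m₁ m₂ : W} {j : ℕ}
    (hdim : Module.finrank K (N (κ + δ + j)) = δ + j + 1 + (j + 1))
    (hgen : ∀ x ∈ N (κ + δ + j), ∃ p q : STRing K,
      p.IsHomogeneous (δ + j) ∧ q.IsHomogeneous j ∧ x = ρ p m₁ + ρ q m₂)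
    {p q : STRing K} (hp : p.IsHomogeneous (δ + j)) (hq : q.IsHomogeneous j)
    (hpq : ρ p m₁ + ρ q m₂ = 0) : p = 0 ∧ q = 0 := by
  let T : STRing K × STRing K →ₗ[K] W :=
    (ρ.toLinearMap.flip m₁).coprod (ρ.toLinearMap.flip m₂)
  set P := (homogeneousSubmodule (Fin 2) K (δ + j)).prod (homogeneousSubmodule (Fin 2) K j)
  have h := finrank_map_add_finrank_inf_ker P T
  rw [finrank_submodule_prod, finrank_homogeneousSubmodule, finrank_homogeneousSubmodule] at h
  have hle : N (κ + δ + j) ≤ P.map T := by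
    intro x hx
    obtain ⟨p, q, hp, hq, rfl⟩ := hgen x hx
    exact ⟨(p, q), ⟨hp, hq⟩, rfl⟩
  have h1 := Submodule.finrank_mono hle
  -- Source and target have equal dimension, so surjectivity of T onto N forces injectivity on P.
  have h2 : P ⊓ LinearMap.ker T = ⊥ := by
    rw [← Submodule.finrank_eq_zero (R := K)]
    omega
  have h3 : (p, q) ∈ P ⊓ LinearMap.ker T := ⟨⟨hp, hq⟩, hpq⟩
  rw [h2] at h3
  simpa using h3

end

/-! ### The ideal of the points as a saturated family -/

lemma exists_dual_eq_one {A : Fin 2 → K} (hA : A ≠ 0) :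
    ∃ l : Fin 2 → K, l 0 * A 0 + l 1 * A 1 = 1 := by
  by_cases h : A 0 = 0
  · have h1 : A 1 ≠ 0 := fun h1 ↦ hA (by ext i; fin_cases i <;> assumption)
    exact ⟨![0, (A 1)⁻¹], by simp [h1]⟩
  · exact ⟨![(A 0)⁻¹, 0], by simp [h]⟩

/-- The parametrization of the cone over the point `A × B`. -/
noncomputable def conePullback (A B : Fin 2 → K) : CoxRing K →ₐ[K] MvPolynomial (Fin 2) K :=
  aeval (Sum.elim (fun i ↦ C (A i) * X 0) (fun i ↦ C (B i) * X 1))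

/-- The ideal of a point is the kernel of the parametrization of its cone. -/
lemma mem_pointIdeal_iff (P : P1 K × P1 K) (z : CoxRing K) :
    z ∈ pointIdeal P ↔ conePullback P.1.rep P.2.rep z = 0 := by
  constructor
  · intro hz
    have hle : pointIdeal P ≤ RingHom.ker (conePullback P.1.rep P.2.rep).toRingHom := by
      rw [pointIdeal, Ideal.span_le]
      rintro _ (rfl | rfl) <;>
      · simp [conePullback, RingHom.mem_ker, ← algebraMap_eq]
        ring
    exact hle hz
  · intro hz
    obtain ⟨l, hl⟩ := exists_dual_eq_one P.1.rep_nonzero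
    obtain ⟨m, hm⟩ := exists_dual_eq_one P.2.rep_nonzero
    set A := P.1.rep with hA
    set B := P.2.rep with hB
    -- The parameters go to linear forms with value 1 at A and at B; modulo `pointIdeal P` this
    -- inverts the parametrization on each variable.
    let ψ : MvPolynomial (Fin 2) K →ₐ[K] CoxRing K :=
      aeval ![C (l 0) * X (.inl 0) + C (l 1) * X (.inl 1),
        C (m 0) * X (.inr 0) + C (m 1) * X (.inr 1)]
    have hψ : (Ideal.Quotient.mkₐ K (pointIdeal P)).comp (ψ.comp (conePullback A B)) =
        Ideal.Quotient.mkₐ K (pointIdeal P) := by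
      have h1 : C (A 1) * X (.inl 0) - C (A 0) * X (.inl 1) ∈ pointIdeal P :=
        Ideal.subset_span (by simp [hA])
      have h2 : C (B 1) * X (.inr 0) - C (B 0) * X (.inr 1) ∈ pointIdeal P :=
        Ideal.subset_span (by simp [hB])
      have hl' : (C (l 0) * C (A 0) + C (l 1) * C (A 1) : CoxRing K) = 1 := by
        rw [← map_mul, ← map_mul, ← map_add, hl, map_one]
      have hm' : (C (m 0) * C (B 0) + C (m 1) * C (B 1) : CoxRing K) = 1 := by
        rw [← map_mul, ← map_mul, ← map_add, hm, map_one]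
      apply algHom_ext
      rintro (i | i) <;> fin_cases i
      all_goals
        simp only [AlgHom.comp_apply, Ideal.Quotient.mkₐ_eq_mk]
        rw [Ideal.Quotient.eq]
        simp [conePullback, ψ, algHom_C, algebraMap_eq]
      · convert Ideal.mul_mem_left _ (-C (l 1)) h1 using 1
        linear_combination (X (.inl 0)) * hl'
      · convert Ideal.mul_mem_left _ (C (l 0)) h1 using 1
        linear_combination (X (.inl 1)) * hl'
      · convert Ideal.mul_mem_left _ (-C (m 1)) h2 using 1
        linear_combination (X (.inr 0)) * hm'
      · convert Ideal.mul_mem_left _ (C (m 0)) h2 using 1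
        linear_combination (X (.inr 1)) * hm'
    have h := DFunLike.congr_fun hψ z
    simp only [AlgHom.comp_apply, hz, map_zero] at h
    exact Ideal.Quotient.eq_zero_iff_mem.1 h.symm

/-- The parametrization takes values in a domain: if z had nonzero image, both coordinates of the
first factor of P would vanish. -/
lemma mem_pointIdeal_of_X_mul {P : P1 K × P1 K} {z : CoxRing K}
    (h : ∀ i : Fin 2, X (.inl i) * z ∈ pointIdeal P) : z ∈ pointIdeal P := by
  rw [mem_pointIdeal_iff]
  by_contra hz
  refine P.1.rep_nonzero (funext fun i ↦ ?_)
  have := h i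
  rw [mem_pointIdeal_iff, map_mul, mul_eq_zero_iff_right hz] at this
  simpa [conePullback] using this

lemma mem_pointsIdeal_of_X_mul {Y : Finset (P1 K × P1 K)} {z : CoxRing K}
    (h : ∀ i : Fin 2, X (.inl i) * z ∈ pointsIdeal Y) : z ∈ pointsIdeal Y := by
  simp only [pointsIdeal, Submodule.mem_iInf] at h ⊢
  exact fun P hP ↦ mem_pointIdeal_of_X_mul fun i ↦ h i P hP

instance (Y : Finset (P1 K × P1 K)) (i j : ℕ) : Module.Finite K (pointsIdealPiece Y i j) :=
  Submodule.finiteDimensional_of_le (inf_le_right : _ ≤ bidegPiece K i j)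

variable (K) in
/-- Multiplication of `K[s,t]` on the total coordinate ring. -/
noncomputable def coxAction : STRing K →ₐ[K] Module.End K (CoxRing K) :=
  (Algebra.lmul K (CoxRing K)).comp (rename Sum.inl)

@[simp]
lemma coxAction_apply (p : STRing K) (x : CoxRing K) :
    coxAction K p x = rename Sum.inl p * x := rfl

lemma rename_inl_eq_zero_iff {p : STRing K} :
    rename (Sum.inl : Fin 2 → Fin 2 ⊕ Fin 2) p = 0 ↔ p = 0 :=
  map_eq_zero_iff _ (rename_injective _ Sum.inl_injective)

lemma X_mul_mem_pointsIdealPiece {Y : Finset (P1 K × P1 K)} {n j : ℕ} (i : Fin 2) {x : CoxRing K}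
    (hx : x ∈ pointsIdealPiece Y n j) : X (.inl i) * x ∈ pointsIdealPiece Y (n + 1) j := by
  refine ⟨Ideal.mul_mem_left _ _ hx.1, ?_⟩
  change IsWeightedHomogeneous biweight _ _
  convert (isWeightedHomogeneous_X K biweight (.inl i)).mul hx.2 using 1
  simp [biweight, add_comm]

lemma isSaturatedFamily_pointsIdealPiece (Y : Finset (P1 K × P1 K)) (j : ℕ) :
    IsSaturatedFamily (coxAction K) fun n ↦ pointsIdealPiece Y n j where
  X_mem i n x hx := by simpa using X_mul_mem_pointsIdealPiece i hx
  koszul n x hx y hy h := by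
    have h' : X (.inl 0) ^ 1 * x = X (.inl 1) ^ 1 * y := by simpa using h
    obtain ⟨z, rfl, rfl⟩ := exists_eq_X_pow_mul (by simp) h'
    simp only [pow_one] at hx hy ⊢
    refine ⟨z, by simp, by simp, ?_, ?_⟩
    · rintro rfl
      exact eq_zero_of_X_mul_mem_bidegPiece_zero hx.2
    · rintro m rfl
      refine ⟨mem_pointsIdeal_of_X_mul fun i ↦ ?_, mem_bidegPiece_of_X_mul hx.2⟩
      fin_cases i
      exacts [hy.1, hx.1]
  torsionFree p x h := by simpa [rename_inl_eq_zero_iff] using h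

lemma IsGenericPoints.finrank_pointsIdealPiece {Y : Finset (P1 K × P1 K)} (hY : IsGenericPoints Y)
    {n : ℕ} (hn : Y.card ≤ 2 * (n + 1)) :
    Module.finrank K (pointsIdealPiece Y n 1) + Y.card = 2 * (n + 1) := by
  have h := hY n 1
  -- This inequality makes the truncated subtraction in `hilbertFunction` a true one.
  have hle : Module.finrank K (pointsIdealPiece Y n 1) ≤ Module.finrank K (bidegPiece K n 1) :=
    Submodule.finrank_mono inf_le_right
  rw [hilbertFunction, finrank_bidegPiece] at h
  rw [finrank_bidegPiece] at hle
  omega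

/-! ### The syzygies as a saturated family -/

/-- The map `L ↦ ∑ Lₘ fₘ` whose kernel consists of the syzygies. -/
noncomputable def syzMap (f : Fin 4 → CoxRing K) : (Fin 4 → STRing K) →ₗ[K] CoxRing K :=
  ∑ m, (coxAction K).toLinearMap.flip (f m) ∘ₗ LinearMap.proj m

lemma syzMap_apply (f : Fin 4 → CoxRing K) (L : Fin 4 → STRing K) :
    syzMap f L = ∑ m, rename Sum.inl (L m) * f m := by
  simp [syzMap]

lemma mem_syzDegZero_iff {f : Fin 4 → CoxRing K} {L : Fin 4 → STRing K} :
    L ∈ syzDegZero f ↔ syzMap f L = 0 := by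
  rw [syzMap_apply]; rfl

lemma syzMap_smul (f : Fin 4 → CoxRing K) (p : STRing K) (L : Fin 4 → STRing K) :
    syzMap f (p • L) = rename Sum.inl p * syzMap f L := by
  simp [syzMap_apply, Finset.mul_sum, mul_assoc]

variable (K) in
/-- Quadruples of forms of degree `e`. -/
noncomputable def formTuples (e : ℕ) : Submodule K (Fin 4 → STRing K) :=
  Submodule.pi Set.univ fun _ ↦ homogeneousSubmodule (Fin 2) K e

lemma mem_formTuples {e : ℕ} {L : Fin 4 → STRing K} :
    L ∈ formTuples K e ↔ ∀ m, (L m).IsHomogeneous e := by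
  simp [formTuples, Submodule.mem_pi]

variable (K) in
/-- Quadruples of forms are functions to the space of forms. -/
noncomputable def formTuplesEquiv (e : ℕ) :
    formTuples K e ≃ₗ[K] (Fin 4 → homogeneousSubmodule (Fin 2) K e) where
  toFun L m := ⟨L.1 m, mem_formTuples.1 L.2 m⟩
  invFun L := ⟨fun m ↦ L m, mem_formTuples.2 fun m ↦ (L m).2⟩
  map_add' _ _ := rfl
  map_smul' _ _ := rfl

instance (e : ℕ) : Module.Finite K (formTuples K e) :=
  Module.Finite.equiv (formTuplesEquiv K e).symm

variable (K) in
lemma finrank_formTuples (e : ℕ) : Module.finrank K (formTuples K e) = 4 * (e + 1) := by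
  rw [(formTuplesEquiv K e).finrank_eq, Module.finrank_pi_fintype]
  simp [finrank_homogeneousSubmodule]

/-- Syzygies of bidegree `(e,0)`. -/
noncomputable def syzPiece (f : Fin 4 → CoxRing K) (e : ℕ) : Submodule K (Fin 4 → STRing K) :=
  formTuples K e ⊓ LinearMap.ker (syzMap f)

instance (f : Fin 4 → CoxRing K) (e : ℕ) : Module.Finite K (syzPiece f e) :=
  Submodule.finiteDimensional_of_le (inf_le_left : _ ≤ formTuples K e)

/-- Division is carried out entry by entry. The quotient is again a syzygy because t times it is one
and the coordinate ring is a domain. -/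
lemma isSaturatedFamily_syzPiece (f : Fin 4 → CoxRing K) :
    IsSaturatedFamily (Algebra.lsmul K K (Fin 4 → STRing K)) (syzPiece f) where
  X_mem i n x hx := by
    refine ⟨mem_formTuples.2 fun m ↦ ?_, ?_⟩
    · simpa [add_comm] using (isHomogeneous_X K i).mul (mem_formTuples.1 hx.1 m)
    · simp [syzMap_smul, LinearMap.mem_ker.1 hx.2]
  koszul n x hx y hy h := by
    have h' (m : Fin 4) : X 0 ^ 1 * x m = X 1 ^ 1 * y m := by simpa using congrFun h m
    choose z hz hz' using fun m ↦ exists_eq_X_pow_mul (by simp) (h' m)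
    simp only [pow_one] at hz hz'
    obtain rfl : x = fun m ↦ X 1 * z m := funext hz
    obtain rfl : y = fun m ↦ X 0 * z m := funext hz'
    refine ⟨z, rfl, rfl, ?_, ?_⟩
    · rintro rfl
      exact funext fun m ↦ eq_zero_of_X_mul_isHomogeneous_zero (mem_formTuples.1 hx.1 m)
    · rintro m rfl
      refine ⟨mem_formTuples.2 fun m ↦ isHomogeneous_of_X_mul (mem_formTuples.1 hx.1 m), ?_⟩
      have h0 : syzMap f ((X 1 : STRing K) • z) = 0 := hx.2
      rw [syzMap_smul, mul_eq_zero, rename_inl_eq_zero_iff] at h0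
      exact h0.resolve_left (X_ne_zero _)
  torsionFree p x h := smul_eq_zero.1 h

/-! ### Zariski open conditions -/

/-- Covering a given finite-dimensional space is an open condition in a linear family of maps. -/
lemma exists_polynomial_le_range {ι E W : Type*} [Fintype ι] [AddCommGroup E]
    [Module K E] [AddCommGroup W] [Module K W] (Φ : (ι → K) →ₗ[K] E →ₗ[K] W)
    (V : Submodule K W) [FiniteDimensional K V] {c₀ : ι → K}
    (h₀ : V ≤ LinearMap.range (Φ c₀)) :
    ∃ F : MvPolynomial ι K, F ≠ 0 ∧ ∀ c, eval c F ≠ 0 → LinearMap.range (Φ c) ≤ V →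
      V ≤ LinearMap.range (Φ c) := by
  classical
  obtain ⟨π, hπ⟩ := LinearMap.exists_leftInverse_of_injective V.subtype V.ker_subtype
  have hπV (x : V) : π x = x := LinearMap.congr_fun hπ x
  have hsurj : Function.Surjective (π ∘ₗ Φ c₀) := by
    intro x
    obtain ⟨y, hy⟩ := h₀ x.2
    exact ⟨y, by simp [hy, hπV]⟩
  -- With the section G fixed, det (π ∘ Φ c ∘ G) is a polynomial in c with value 1 at c₀, and its
  -- nonvanishing makes π ∘ Φ c surjective.
  obtain ⟨G, hG⟩ := (π ∘ₗ Φ c₀).exists_rightInverse_of_surjective (LinearMap.range_eq_top.2 hsurj)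
  let b := Module.finBasis K V
  let A (i : ι) := LinearMap.toMatrix b b (π ∘ₗ Φ (Pi.single i 1) ∘ₗ G)
  let B : Matrix _ _ (MvPolynomial ι K) := ∑ i, (X i : MvPolynomial ι K) • (A i).map (C : K → MvPolynomial ι K)
  have hB (c : ι → K) : eval c B.det = LinearMap.det (π ∘ₗ Φ c ∘ₗ G) := by
    rw [← LinearMap.det_toMatrix b, RingHom.map_det]
    congr 1
    have hc : π ∘ₗ Φ c ∘ₗ G = ∑ i, c i • (π ∘ₗ Φ (Pi.single i 1) ∘ₗ G) := by
      have : c = ∑ i, c i • (Pi.single i 1 : ι → K) := by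
        ext j; simp [Finset.sum_apply, Pi.single_apply]
      conv_lhs => rw [this]
      ext x
      simp
    rw [hc, map_sum]
    ext i j
    simp [A, Matrix.sum_apply]
  refine ⟨B.det, fun h ↦ ?_, fun c hc hle x hx ↦ ?_⟩
  · have := hB c₀
    rw [h, map_zero, ← LinearMap.comp_assoc, hG, LinearMap.det_id] at this
    exact zero_ne_one this
  · rw [hB] at hc
    have hu := (LinearMap.isUnit_iff_isUnit_det _).2 (isUnit_iff_ne_zero.2 hc)
    obtain ⟨y, hy⟩ := ((Module.End.isUnit_iff _).1 hu).2 ⟨x, hx⟩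
    refine ⟨G y, ?_⟩
    have := congrArg Subtype.val hy
    -- The range of Φ c lies in V, where π is the identity, so π can be removed.
    have h1 := hπV ⟨Φ c (G y), hle ⟨_, rfl⟩⟩
    simpa [h1] using this

/-- The product of the maximal minors of the generic matrix. -/
lemma exists_polynomial_minors_ne_zero (n q : ℕ) :
    ∃ F : MvPolynomial (Fin n × Fin q) K, F ≠ 0 ∧ ∀ A : Matrix (Fin n) (Fin q) K,
      eval (fun x ↦ A x.1 x.2) F ≠ 0 → ∀ e : Fin n ↪o Fin q, (A.submatrix id e).det ≠ 0 := by
  classical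
  let B (e : Fin n ↪o Fin q) : Matrix (Fin n) (Fin n) (MvPolynomial (Fin n × Fin q) K) :=
    .of fun i j ↦ X (i, e j)
  have hB (e : Fin n ↪o Fin q) (A : Matrix (Fin n) (Fin q) K) :
      eval (fun x ↦ A x.1 x.2) (B e).det = (A.submatrix id e).det := by
    rw [RingHom.map_det]
    congr 1
    ext i j
    simp [B]
  refine ⟨∏ e, (B e).det, Finset.prod_ne_zero_iff.2 fun e _ h ↦ ?_, fun A hA e ↦ ?_⟩
  · have h1 := hB e (.of fun i m ↦ if e i = m then 1 else 0)
    have h2 : (Matrix.of fun i m ↦ if e i = m then (1 : K) else 0).submatrix id e = 1 := by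
      ext i j
      simp [Matrix.one_apply]
    rw [h, map_zero, h2, Matrix.det_one] at h1
    exact zero_ne_one h1
  · rw [map_prod, Finset.prod_ne_zero_iff] at hA
    rw [← hB]
    exact hA e (Finset.mem_univ e)

/-! ### Homogeneous components and covering by forms -/

lemma homogeneousComponent_mul_add {σ : Type*} {m n : ℕ} (p : MvPolynomial σ K)
    {g : MvPolynomial σ K} (hg : g.IsHomogeneous n) :
    homogeneousComponent (m + n) (p * g) = homogeneousComponent m p * g := by
  classical
  conv_lhs => rw [← sum_homogeneousComponent p]
  rw [Finset.sum_mul, map_sum]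
  have h (i : ℕ) : homogeneousComponent (m + n) (homogeneousComponent i p * g) =
      if i = m then homogeneousComponent m p * g else 0 := by
    rw [homogeneousComponent_of_mem (n := i + n) ((homogeneousComponent_isHomogeneous i p).mul hg)]
    by_cases hi : i = m
    · simp [hi]
    · simp [hi, Ne.symm hi]
  simp_rw [h]
  rw [Finset.sum_ite_eq']
  split_ifs with he
  · rfl
  · rw [homogeneousComponent_eq_zero _ _ (by simpa using he)]
    simp

lemma rename_inl_mem_bidegPiece {p : STRing K} {e : ℕ} (hp : p.IsHomogeneous e) :
    rename Sum.inl p ∈ bidegPiece K e 0 := by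
  induction hp using IsWeightedHomogeneous.induction_on with
  | zero => simp
  | add p q hp hq ihp ihq => simpa using Submodule.add_mem _ ihp ihq
  | monomial d r hd =>
    rw [rename_monomial]
    refine isWeightedHomogeneous_monomial _ _ _ ?_
    rw [weight_biweight, Finsupp.mapDomain_apply Sum.inl_injective,
      Finsupp.mapDomain_apply Sum.inl_injective, Finsupp.mapDomain_of_notMem_range _ _ (by simp),
      Finsupp.mapDomain_of_notMem_range _ _ (by simp)]
    simpa [Finsupp.weight_apply, Finsupp.sum_fintype] using hd

lemma rename_inl_mul_mem_bidegPiece {p : STRing K} {e i j : ℕ} (hp : p.IsHomogeneous e)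
    {x : CoxRing K} (hx : x ∈ bidegPiece K i j) :
    rename Sum.inl p * x ∈ bidegPiece K (i + e) j := by
  have := (show IsWeightedHomogeneous biweight _ _ from rename_inl_mem_bidegPiece hp).mul
    (show IsWeightedHomogeneous biweight _ _ from hx)
  rwa [Prod.mk_add_mk, zero_add, add_comm] at this

lemma weightedHomogeneousComponent_rename_inl_mul (p : STRing K) {i j : ℕ} (e : ℕ)
    {x : CoxRing K} (hx : x ∈ bidegPiece K i j) :
    weightedHomogeneousComponent biweight (i + e, j) (rename Sum.inl p * x) =
      rename Sum.inl (homogeneousComponent e p) * x := by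
  classical
  conv_lhs => rw [← sum_homogeneousComponent p]
  rw [map_sum, Finset.sum_mul, map_sum]
  have h (n : ℕ) : weightedHomogeneousComponent biweight (i + e, j)
      (rename Sum.inl (homogeneousComponent n p) * x) =
      if n = e then rename Sum.inl (homogeneousComponent e p) * x else 0 := by
    rw [weightedHomogeneousComponent_of_mem (n := (i + n, j))
      (rename_inl_mul_mem_bidegPiece (homogeneousComponent_isHomogeneous n p) hx)]
    by_cases hn : n = e
    · simp [hn]
    · simp [hn, Ne.symm hn]
  simp_rw [h]
  rw [Finset.sum_ite_eq']
  split_ifs with he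
  · rfl
  · rw [homogeneousComponent_eq_zero _ _ (by simpa using he)]
    simp

/-- The homogeneous components of a syzygy are syzygies. -/
lemma homogeneousComponent_mem_syzPiece {f : Fin 4 → CoxRing K} {a j : ℕ}
    (hf : ∀ m, f m ∈ bidegPiece K a j) {L : Fin 4 → STRing K} (hL : L ∈ syzDegZero f) (e : ℕ) :
    (fun m ↦ homogeneousComponent e (L m)) ∈ syzPiece f e := by
  refine ⟨mem_formTuples.2 fun m ↦ homogeneousComponent_isHomogeneous e _, ?_⟩
  rw [mem_syzDegZero_iff, syzMap_apply] at hL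
  have := congrArg (weightedHomogeneousComponent biweight (a + e, j)) hL
  rw [map_sum, map_zero] at this
  change syzMap f _ = 0
  rw [syzMap_apply, ← this]
  exact Finset.sum_congr rfl fun m _ ↦
    (weightedHomogeneousComponent_rename_inl_mul (L m) e (hf m)).symm

lemma mem_pointsIdealPiece_of_isHomogeneous {Y : Finset (P1 K × P1 K)} {p : STRing K} {e n j : ℕ}
    (hp : p.IsHomogeneous e) {x : CoxRing K} (hx : x ∈ pointsIdealPiece Y n j) :
    rename Sum.inl p * x ∈ pointsIdealPiece Y (n + e) j :=
  ⟨Ideal.mul_mem_left _ _ hx.1, rename_inl_mul_mem_bidegPiece hp hx.2⟩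

lemma map_syzMap_le {Y : Finset (P1 K × P1 K)} {f : Fin 4 → CoxRing K} {a j : ℕ}
    (hf : ∀ m, f m ∈ pointsIdealPiece Y a j) (e : ℕ) :
    (formTuples K e).map (syzMap f) ≤ pointsIdealPiece Y (a + e) j := by
  rintro _ ⟨L, hL, rfl⟩
  rw [syzMap_apply]
  exact Submodule.sum_mem _ fun m _ ↦
    mem_pointsIdealPiece_of_isHomogeneous (mem_formTuples.1 hL m) (hf m)

/-- This transfers the covering property from the rows of the coefficient matrix to an arbitrary
basis of U. -/
lemma map_syzMap_mono {f g : Fin 4 → CoxRing K} {e : ℕ}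
    (h : ∀ m, g m ∈ Submodule.span K (Set.range f)) :
    (formTuples K e).map (syzMap g) ≤ (formTuples K e).map (syzMap f) := by
  classical
  rintro _ ⟨L, hL, rfl⟩
  rw [syzMap_apply]
  refine Submodule.sum_mem _ fun m _ ↦ ?_
  have hle : Submodule.span K (Set.range f) ≤
      ((formTuples K e).map (syzMap f)).comap (coxAction K (L m)) := by
    rw [Submodule.span_le]
    rintro _ ⟨i, rfl⟩
    refine ⟨Pi.single i (L m), mem_formTuples.2 fun j ↦ ?_, ?_⟩
    · by_cases hj : j = i
      · subst hj; simpa using mem_formTuples.1 hL m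
      · simpa [hj] using isHomogeneous_zero ..
    · rw [syzMap_apply, Finset.sum_eq_single i]
      · simp
      · intro j _ hj; simp [hj]
      · simp
  exact hle (h m)

/-! ### The balanced basis of the syzygy module -/

/-- Membership in a free rank two submodule can be tested after multiplication by
powers of both variables. -/
lemma mem_span_pair_of_X_pow_smul {g₁ g₂ L : Fin 4 → STRing K}
    (hind : ∀ p q : STRing K, p • g₁ + q • g₂ = 0 → p = 0 ∧ q = 0) {n : ℕ}
    (h : ∀ i : Fin 2, (X i ^ n : STRing K) • L ∈ Submodule.span (STRing K) {g₁, g₂}) :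
    L ∈ Submodule.span (STRing K) {g₁, g₂} := by
  obtain ⟨p, q, hpq⟩ := Submodule.mem_span_pair.1 (h 0)
  obtain ⟨p', q', hpq'⟩ := Submodule.mem_span_pair.1 (h 1)
  obtain ⟨h1, h2⟩ := hind (X 1 ^ n * p - X 0 ^ n * p') (X 1 ^ n * q - X 0 ^ n * q') (by
    rw [sub_smul, sub_smul, mul_smul, mul_smul, mul_smul, mul_smul]
    have h1 : (X 1 ^ n : STRing K) • (p • g₁ + q • g₂) =
        (X 0 ^ n : STRing K) • (p' • g₁ + q' • g₂) := by
      rw [hpq, hpq', smul_smul, smul_smul, mul_comm]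
    rw [smul_add, smul_add] at h1
    linear_combination h1)
  -- By coprimality of the two powers, s^n divides both coefficients of s^n L, and can be cancelled.
  obtain ⟨z, rfl, -⟩ := exists_eq_X_pow_mul (by simp) (sub_eq_zero.1 h1)
  obtain ⟨w, rfl, -⟩ := exists_eq_X_pow_mul (by simp) (sub_eq_zero.1 h2)
  refine Submodule.mem_span_pair.2 ⟨z, w, ?_⟩
  rw [mul_smul, mul_smul, ← smul_add] at hpq
  exact smul_right_injective _ (pow_ne_zero n (X_ne_zero (R := K) (0 : Fin 2))) hpq

/-- The degree zero syzygies of four elements of `(I_Y)_(a,1)` are free of rank two and balanced,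
as soon as the forms of degree `a - k - 1` cover `(I_Y)_(2a-k-1,1)`. -/
theorem exists_syzygy_basis {Y : Finset (P1 K × P1 K)} (hY : IsGenericPoints Y) {k δ e : ℕ}
    (hδ : δ ≤ 1) (hr : Y.card = 2 * k + δ)
    {f : Fin 4 → CoxRing K} (hf : ∀ m, f m ∈ pointsIdealPiece Y (k + (e + 1)) 1)
    (hsurj : pointsIdealPiece Y (k + (e + 1) + e) 1 ≤ (formTuples K e).map (syzMap f)) :
    ∃ g₁ ∈ syzPiece f (e + 1 - δ), ∃ g₂ ∈ syzPiece f (e + 1),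
      (∀ p q : STRing K, p • g₁ + q • g₂ = 0 → p = 0 ∧ q = 0) ∧
      Submodule.span (STRing K) {g₁, g₂} = syzDegZero f := by
  set a := k + (e + 1) with ha
  have hM := isSaturatedFamily_pointsIdealPiece Y 1
  have hN := isSaturatedFamily_syzPiece f
  -- Covering in degree e propagates upwards, since M_(n+1) = s M_n + t M_n in this range.
  have hcover (i : ℕ) :
      pointsIdealPiece Y (a + (e + i)) 1 ≤ (formTuples K (e + i)).map (syzMap f) := by
    induction i with
    | zero => exact hsurj
    | succ i ih =>
      intro w hw
      obtain ⟨x, hx, y, hy, rfl⟩ := hM.exists_eq_X_add_X (r := Y.card)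
        (fun n hn ↦ hY.finrank_pointsIdealPiece hn) (n := a + (e + i)) (by omega) hw
      obtain ⟨L, hL, rfl⟩ := ih hx
      obtain ⟨L', hL', rfl⟩ := ih hy
      refine ⟨(X 0 : STRing K) • L + (X 1 : STRing K) • L', ?_, ?_⟩
      · refine mem_formTuples.2 fun m ↦ ?_
        have h0 := (mem_formTuples.1 hL m).mul (isHomogeneous_X K 0)
        have h1 := (mem_formTuples.1 hL' m).mul (isHomogeneous_X K 1)
        simpa [mul_comm, ← add_assoc] using h0.add h1
      · rw [map_add, syzMap_smul, syzMap_smul]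
        rfl
  -- The threshold amounts to n ≥ e. The value is 4(n+1) - dim M_(a+n), with r = 2k + δ and a = k +
  -- e + 1.
  have hdim (n : ℕ) (hn : 2 * (e + 1 - δ) + δ ≤ 2 * (n + 1)) :
      Module.finrank K (syzPiece f n) + (2 * (e + 1 - δ) + δ) = 2 * (n + 1) := by
    obtain ⟨i, rfl⟩ := Nat.exists_eq_add_of_le (show e ≤ n by omega)
    have h1 := finrank_map_add_finrank_inf_ker (formTuples K (e + i)) (syzMap f)
    rw [le_antisymm (map_syzMap_le hf (e + i)) (hcover i), finrank_formTuples] at h1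
    have h2 := hY.finrank_pointsIdealPiece (n := a + (e + i)) (by omega)
    change _ + Module.finrank K (syzPiece f (e + i)) = _ at h1
    omega
  obtain ⟨g₁, hg₁, g₂, hg₂, hgen⟩ := hN.exists_generators hδ rfl hdim
  have hδe : e + 1 - δ + δ = e + 1 := by omega
  have hzero (j : ℕ) {p q : STRing K} (hp : p.IsHomogeneous (δ + j)) (hq : q.IsHomogeneous j)
      (hpq : p • g₁ + q • g₂ = 0) : p = 0 ∧ q = 0 := by
    refine eq_zero_of_generators (ρ := Algebra.lsmul K K (Fin 4 → STRing K)) (N := syzPiece f)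
      (κ := e + 1 - δ) ?_ (hgen j) hp hq hpq
    have := hdim (e + 1 - δ + δ + j) (by omega)
    omega
  rw [hδe] at hg₂
  have hg₁0 : g₁ ≠ 0 := by
    rintro rfl
    have := (hzero 0 (p := X 0 ^ δ) (q := 0) (isHomogeneous_X_pow ..) (isHomogeneous_zero ..)
      (by simp)).1
    exact pow_ne_zero _ (X_ne_zero _) this
  have hcomp (p q : STRing K) (hpq : p • g₁ + q • g₂ = 0) (j : ℕ) :
      homogeneousComponent (δ + j) p = 0 ∧ homogeneousComponent j q = 0 := by
    refine hzero j (homogeneousComponent_isHomogeneous ..) (homogeneousComponent_isHomogeneous ..) ?_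
    ext1 m
    have h := congrArg (homogeneousComponent (j + (e + 1))) (congrFun hpq m)
    simp only [Pi.add_apply, Pi.smul_apply, smul_eq_mul, map_add, Pi.zero_apply, map_zero] at h ⊢
    rwa [homogeneousComponent_mul_add q (mem_formTuples.1 hg₂.1 m),
      show j + (e + 1) = δ + j + (e + 1 - δ) by omega,
      homogeneousComponent_mul_add p (mem_formTuples.1 hg₁.1 m)] at h
  -- `hcomp` sees every component of q but misses those of p in degrees below δ. Hence q is shown to
  -- vanish first, and then p by torsion-freeness.
  have hind (p q : STRing K) (hpq : p • g₁ + q • g₂ = 0) : p = 0 ∧ q = 0 := by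
    obtain rfl : q = 0 := by
      rw [← sum_homogeneousComponent q]
      exact Finset.sum_eq_zero fun j _ ↦ (hcomp p q hpq j).2
    rw [zero_smul, add_zero] at hpq
    exact ⟨(smul_eq_zero.1 hpq).resolve_right hg₁0, rfl⟩
  refine ⟨g₁, hg₁, g₂, hg₂, hind, le_antisymm ?_ fun L hL ↦ ?_⟩
  · rw [Submodule.span_le]
    rintro _ (rfl | rfl)
    exacts [mem_syzDegZero_iff.2 hg₁.2, mem_syzDegZero_iff.2 hg₂.2]
  · have hsum : L = ∑ i ∈ Finset.range (Finset.univ.sup (fun m ↦ (L m).totalDegree) + 1),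
        fun m ↦ homogeneousComponent i (L m) := by
      ext1 m
      rw [Finset.sum_apply]
      conv_lhs => rw [← sum_homogeneousComponent (L m)]
      refine Finset.sum_subset ?_ ?_
      · intro i hi
        have := Finset.le_sup (f := fun m ↦ (L m).totalDegree) (Finset.mem_univ m)
        simp only [Finset.mem_range] at hi ⊢
        omega
      · intro i _ hi
        exact homogeneousComponent_eq_zero _ _ (by simpa using hi)
    rw [hsum]
    -- `hgen` only describes degrees at least e + 1, so each component is first multiplied by
    -- s^(e+1) and by t^(e+1) to reach them.
    refine Submodule.sum_mem _ fun n _ ↦ mem_span_pair_of_X_pow_smul hind (n := e + 1) fun i ↦ ?_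
    have hLn := homogeneousComponent_mem_syzPiece (fun m ↦ (hf m).2) hL n
    obtain ⟨p, q, -, -, hpq⟩ := hgen n ((X i ^ (e + 1) : STRing K) •
        fun m ↦ homogeneousComponent n (L m)) (by
      refine ⟨mem_formTuples.2 fun m ↦ ?_, ?_⟩
      · have := (isHomogeneous_X_pow (R := K) i (e + 1)).mul (mem_formTuples.1 hLn.1 m)
        rwa [hδe]
      · change syzMap f _ = 0
        rw [syzMap_smul, LinearMap.mem_ker.1 hLn.2, mul_zero])
    rw [hpq]
    exact Submodule.mem_span_pair.2 ⟨p, q, rfl⟩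

/-! ### Covering by generic quadruples -/

/-- Over generic points there are four elements of `(I_Y)_(a,1)` whose multiples by forms of
degree `a - k - 1` cover `(I_Y)_(2a-k-1,1)`. -/
theorem exists_covering_tuple {Y : Finset (P1 K × P1 K)} (hY : IsGenericPoints Y) {k δ e : ℕ}
    (hδ : δ ≤ 1) (hr : Y.card = 2 * k + δ) :
    ∃ f : Fin 4 → CoxRing K, (∀ m, f m ∈ pointsIdealPiece Y (k + (e + 1)) 1) ∧
      pointsIdealPiece Y (k + (e + 1) + e) 1 ≤ (formTuples K e).map (syzMap f) := by
  obtain ⟨m₁, hm₁, m₂, hm₂, hgen⟩ := (isSaturatedFamily_pointsIdealPiece Y 1).exists_generators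
    (r := Y.card) hδ hr (fun n hn ↦ hY.finrank_pointsIdealPiece hn)
  have h₁ (i : Fin 2) : rename Sum.inl (X i ^ (e + 1) : STRing K) * m₁ ∈
      pointsIdealPiece Y (k + (e + 1)) 1 :=
    mem_pointsIdealPiece_of_isHomogeneous (isHomogeneous_X_pow ..) hm₁
  have h₂ (i : Fin 2) : rename Sum.inl (X i ^ (e + 1 - δ) : STRing K) * m₂ ∈
      pointsIdealPiece Y (k + (e + 1)) 1 := by
    have := mem_pointsIdealPiece_of_isHomogeneous (isHomogeneous_X_pow (R := K) i (e + 1 - δ)) hm₂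
    rwa [show k + δ + (e + 1 - δ) = k + (e + 1) by omega] at this
  refine ⟨![rename Sum.inl (X 0 ^ (e + 1)) * m₁, rename Sum.inl (X 1 ^ (e + 1)) * m₁,
    rename Sum.inl (X 0 ^ (e + 1 - δ)) * m₂, rename Sum.inl (X 1 ^ (e + 1 - δ)) * m₂],
    ?_, fun x hx ↦ ?_⟩
  · intro m
    fin_cases m
    exacts [h₁ 0, h₁ 1, h₂ 0, h₂ 1]
  · have hidx : k + (e + 1) + e = k + δ + (2 * e + 1 - δ) := by omega
    rw [hidx] at hx
    obtain ⟨p, q, hp, hq, rfl⟩ := hgen _ x hx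
    -- Here p has degree 2e + 1 and q has degree 2e + 1 - δ. Splitting off the exponents e + 1 and e
    -- + 1 - δ leaves four forms of degree e.
    obtain ⟨p₀, p₁, hp₀, hp₁, rfl⟩ :=
      exists_eq_mul_X_pow_add (e := e) (c := e + 1) (by omega) (by omega) hp
    obtain ⟨q₀, q₁, hq₀, hq₁, rfl⟩ :=
      exists_eq_mul_X_pow_add (e := e) (c := e + 1 - δ) (by omega) (by omega) hq
    refine ⟨![p₀, p₁, q₀, q₁], mem_formTuples.2 fun m ↦ ?_, ?_⟩
    · fin_cases m
      exacts [hp₀, hp₁, hq₀, hq₁]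
    · rw [coxAction_apply, coxAction_apply]
      simp [syzMap_apply, Fin.sum_univ_four]
      ring

/-- The tuple of combinations of `w` with coefficient matrix `c`, as a family of syzygy maps. -/
noncomputable def syzMapFamily {q : ℕ} (w : Fin q → CoxRing K) (e : ℕ) :
    (Fin 4 × Fin q → K) →ₗ[K] formTuples K e →ₗ[K] CoxRing K :=
  LinearMap.mk₂ K (fun c L ↦ syzMap (fun i ↦ ∑ m, c (i, m) • w m) L)
    (fun c c' L ↦ by
      simp [syzMap_apply, add_smul, Finset.sum_add_distrib, mul_add])
    (fun t c L ↦ by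
      simp [syzMap_apply, mul_smul, ← Finset.smul_sum])
    (fun c L L' ↦ by simp)
    (fun t c L ↦ by simp)

lemma range_syzMapFamily {q : ℕ} (w : Fin q → CoxRing K) (e : ℕ) (c : Fin 4 × Fin q → K) :
    LinearMap.range (syzMapFamily w e c) =
      (formTuples K e).map (syzMap fun i ↦ ∑ m, c (i, m) • w m) := by
  ext x
  constructor
  · rintro ⟨L, rfl⟩
    exact ⟨L, L.2, rfl⟩
  · rintro ⟨L, hL, rfl⟩
    exact ⟨⟨L, hL⟩, rfl⟩

/-- For generic combinations `f` of a basis of `(I_Y)_(a,1)`, the multiples of `f` by forms of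
degree `a - k - 1` cover `(I_Y)_(2a-k-1,1)`. -/
theorem exists_polynomial_covering {Y : Finset (P1 K × P1 K)} (hY : IsGenericPoints Y) {k δ e : ℕ}
    (hδ : δ ≤ 1) (hr : Y.card = 2 * k + δ) {q : ℕ}
    (b : Module.Basis (Fin q) K (pointsIdealPiece Y (k + (e + 1)) 1)) :
    ∃ F : MvPolynomial (Fin 4 × Fin q) K, F ≠ 0 ∧ ∀ A : Matrix (Fin 4) (Fin q) K,
      eval (fun x ↦ A x.1 x.2) F ≠ 0 → pointsIdealPiece Y (k + (e + 1) + e) 1 ≤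
        (formTuples K e).map (syzMap fun i ↦ ∑ m, A i m • (b m : CoxRing K)) := by
  obtain ⟨f, hf, hcover⟩ := exists_covering_tuple hY (e := e) hδ hr
  have hrows : (fun i ↦ ∑ m, b.repr ⟨f i, hf i⟩ m • (b m : CoxRing K)) = f := by
    funext i
    have := congrArg (Submodule.subtype _) (b.sum_repr ⟨f i, hf i⟩)
    rwa [map_sum] at this
  obtain ⟨F, hF, hF'⟩ := exists_polynomial_le_range (syzMapFamily (fun m ↦ (b m : CoxRing K)) e)
    (pointsIdealPiece Y (k + (e + 1) + e) 1) (c₀ := fun x ↦ b.repr ⟨f x.1, hf x.1⟩ x.2) (by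
      rw [range_syzMapFamily, hrows]
      exact hcover)
  refine ⟨F, hF, fun A hA ↦ ?_⟩
  have := hF' _ hA
  rw [range_syzMapFamily] at this
  exact this (map_syzMap_le (fun i ↦ Submodule.sum_mem _ fun m _ ↦
    Submodule.smul_mem _ _ (b m).2) e)

/-- Independent generators `g₁`, `g₂` are minimal, and their span has rank two. -/
lemma finrank_eq_two_and_hasMinimalGenerators {N : Submodule (STRing K) (Fin 4 → STRing K)}
    {g₁ g₂ : Fin 4 → STRing K} {d₁ d₂ : ℕ}
    (hind : ∀ p q : STRing K, p • g₁ + q • g₂ = 0 → p = 0 ∧ q = 0)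
    (hspan : Submodule.span (STRing K) {g₁, g₂} = N)
    (h₁ : g₁ ∈ formTuples K d₁) (h₂ : g₂ ∈ formTuples K d₂) :
    Module.finrank (STRing K) N = 2 ∧ HasMinimalGenerators N ![d₂, d₁] := by
  have hli : LinearIndependent (STRing K) ![g₂, g₁] :=
    LinearIndependent.pair_iff.2 fun p q h ↦ (hind q p (by rwa [add_comm])).symm
  have hrange : Set.range ![g₂, g₁] = {g₁, g₂} := by
    rw [Matrix.range_cons, Matrix.range_cons, Matrix.range_empty, Set.union_empty,
      Set.singleton_union, Set.pair_comm]
  have hspan' : Submodule.span (STRing K) (Set.range ![g₂, g₁]) = N := by rw [hrange, hspan]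
  refine ⟨?_, ![g₂, g₁], fun i ↦ ?_, hspan', fun i ↦ hli.notMem_span_image (by simp)⟩
  · rw [← hspan']
    simpa using finrank_span_eq_card hli
  · fin_cases i
    exacts [mem_formTuples.1 h₂, mem_formTuples.1 h₁]

end TensorSurface

theorem proposition4p1 {K : Type*} [Field K] [IsAlgClosed K] [CharZero K]
    (X : Finset (TensorSurface.P1 K × TensorSurface.P1 K))
    (hX : TensorSurface.IsGenericPoints X)
    (k a : ℕ) (hk : X.card = 2 * k ∨ X.card = 2 * k + 1) (ha : k ≤ a) :
    TensorSurface.HoldsForGenericSubspace 4 (TensorSurface.pointsIdealPiece X a 1) fun U =>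
      ∀ f : Fin 4 → TensorSurface.CoxRing K,
        LinearIndependent K f → Submodule.span K (Set.range f) = U →
        Module.finrank (TensorSurface.STRing K) (TensorSurface.syzDegZero f) = 2 ∧
        (X.card = 2 * k →
          TensorSurface.HasMinimalGenerators (TensorSurface.syzDegZero f) ![a - k, a - k]) ∧
        (X.card = 2 * k + 1 →
          TensorSurface.HasMinimalGenerators (TensorSurface.syzDegZero f)
            ![a - k, a - k - 1]) := by
  intro q b
  have hq := Module.finrank_eq_card_basis b
  have hdim := hX.finrank_pointsIdealPiece (n := a) (by omega)
  rw [Fintype.card_fin] at hq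
  have hrow (C : Matrix (Fin 4) (Fin q) K) (i : Fin 4) :
      ∑ m, C i m • (b m : TensorSurface.CoxRing K) ∈ TensorSurface.pointsIdealPiece X a 1 :=
    Submodule.sum_mem _ fun m _ ↦ Submodule.smul_mem _ _ (b m).2
  have hspan_le (C : Matrix (Fin 4) (Fin q) K) : Submodule.span K
      (Set.range fun i ↦ ∑ m, C i m • (b m : TensorSurface.CoxRing K)) ≤
      TensorSurface.pointsIdealPiece X a 1 :=
    Submodule.span_le.2 (Set.range_subset_iff.2 (hrow C))
  by_cases hq4 : q < 4
  -- A space of dimension below four contains no four independent elements and its matrices have no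
  -- maximal minors, so everything holds vacuously.
  · refine ⟨1, one_ne_zero, fun C _ ↦ ⟨fun e ↦ ?_, fun f hf hfC ↦ ?_⟩⟩
    · have := Fintype.card_le_of_embedding e.toEmbedding
      simp at this
      omega
    · have h1 := finrank_span_eq_card hf
      have h2 := Submodule.finrank_mono (hspan_le C)
      rw [← hfC, h1, hq, Fintype.card_fin] at h2
      omega
  obtain ⟨δ, hδ, hr⟩ : ∃ δ ≤ 1, X.card = 2 * k + δ := by
    rcases hk with h | h
    exacts [⟨0, by omega, h⟩, ⟨1, le_rfl, h⟩]
  -- Since q = 2(a - k) + 2 - δ is at least 4, a exceeds k.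
  obtain ⟨e, rfl⟩ : ∃ e, a = k + (e + 1) := ⟨a - k - 1, by omega⟩
  obtain ⟨F₁, hF₁, hF₁'⟩ := TensorSurface.exists_polynomial_covering hX hδ hr b
  obtain ⟨F₂, hF₂, hF₂'⟩ := TensorSurface.exists_polynomial_minors_ne_zero (K := K) 4 q
  refine ⟨F₁ * F₂, mul_ne_zero hF₁ hF₂, fun C hC ↦ ?_⟩
  rw [map_mul, mul_ne_zero_iff] at hC
  refine ⟨hF₂' C hC.2, fun f _ hfC ↦ ?_⟩
  have hf (m : Fin 4) : f m ∈ TensorSurface.pointsIdealPiece X (k + (e + 1)) 1 :=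
    hspan_le C (hfC ▸ Submodule.subset_span ⟨m, rfl⟩)
  obtain ⟨g₁, hg₁, g₂, hg₂, hind, hspan⟩ := TensorSurface.exists_syzygy_basis hX hδ hr hf
    ((hF₁' C hC.1).trans (TensorSurface.map_syzMap_mono fun m ↦
      hfC ▸ Submodule.subset_span ⟨m, rfl⟩))
  obtain ⟨h1, h2⟩ :=
    TensorSurface.finrank_eq_two_and_hasMinimalGenerators hind hspan hg₁.1 hg₂.1
  -- After this a - k reads e + 1, the degree of g₂, and for each value of δ the degree e + 1 - δ of
  -- g₁ agrees definitionally with the required one.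
  rw [Nat.add_sub_cancel_left]
  refine ⟨h1, fun h ↦ ?_, fun h ↦ ?_⟩
  · obtain rfl : δ = 0 := by omega
    exact h2
  · obtain rfl : δ = 1 := by omega
    exact h2
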